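/- Let $M$ be a loopless matroid on a finite ground set $E$ with rank function $\operatorname{rk}$, and write $\operatorname{rk} M=\operatorname{rk} E$. Let $\mathcal N^\circ(M)$ be the set of flags (finite chains under inclusion, possibly empty) of flats $F$ of $M$ with $F\neq\operatorname{cl}(\emptyset)$ and $F\neq E$. For $w\in\mathbb R^E$ let $M_w$ be the matroid on $E$ whose bases are the bases $B$ of $M$ for which $\sum_{e\in B}w_e$ is maximal, and for a flag $\mathcal G$ let $M_{\mathcal G}=M_w$, where $w=\sum_{F\in\mathcal G}k_Fv_F$ with $v_F\in\{0,1\}^E$ the indicator vector of $F$ and arbitrary coefficients $k_F>0$ (the matroid $M_{\mathcal G}$ does not depend on the $k_F$). For a matroid $N$ on $E$ let $$\overline\chi_N(q)=\sum_{S\subseteq E}(-1)^{\#S}\,[\operatorname{rk}_N E-\operatorname{rk}_N S]_q\in\mathbb Z[q],\qquad [n]_q=1+q+\dots+q^{n-1},$$ be its reduced characteristic polynomial; for $E\ne\emptyset$ it equals $\chi_N(q)/(q-1)$, where $\chi_N(q)=\sum_{S\subseteq E}(-1)^{\#S}q^{\operatorname{rk}_N E-\operatorname{rk}_N S}$. For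 each $\mathcal F\in\mathcal N^\circ(M)$, define the Poincaré polynomial of $M$ at $\mathcal F$ by $$\overline P_M^{\mathcal F}(q)=\sum_{\substack{\mathcal G\in\mathcal N^\circ(M)\\ \mathcal G\supseteq\mathcal F}}\frac{\overline\chi_{M_{\mathcal G}}(q)}{(q-1)^{\#\mathcal G}}.$$ Then, for every $\mathcal F\in\mathcal N^\circ(M)$, each summand is a polynomial, that is, $(q-1)^{\#\mathcal G}$ divides $\overline\chi_{M_{\mathcal G}}(q)$ in $\mathbb Z[q]$ for every $\mathcal G\in\mathcal N^\circ(M)$ with $\mathcal G\supseteq\mathcal F$, so that $\overline P_M^{\mathcal F}(q)\in\mathbb Z[q]$; and $\overline P_M^{\mathcal F}$ is palindromic: $$\overline P_M^{\mathcal F}(q^{-1})=q^{-(\operatorname{rk}M-1-\#\mathcal F)}\,\overline P_M^{\mathcal F}(q)\quad\text{in }\mathbb Z[q^{\pm1}].$$ -/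

import Mathlib

open Polynomial

noncomputable section

namespace Matroid

variable {α : Type*}

/-! ### Rank and characteristic polynomials -/

/-- The rank of a set, as a natural number (all matroids below have a finite ground set). -/
def rkNat (M : Matroid α) (X : Set α) : ℕ := (M.eRk X).toNat

/-- The rank of the matroid, `rk M = rk_M E`, as a natural number. -/
def rankNat (M : Matroid α) : ℕ := M.rkNat M.E

/-- The finite ground set as a `Finset`. -/
def groundFinset (M : Matroid α) [M.Finite] : Finset α := M.ground_finite.toFinset

/-- The `q`-analogue `[n]_q = 1 + q + ⋯ + q ^ (n - 1)`. -/
def qAnalogue (n : ℕ) : ℤ[X] := ∑ i ∈ Finset.range n, X ^ i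

/-- The characteristic polynomial `χ_M(q) = ∑_{S ⊆ E} (-1)^{#S} q^{rk M - rk S}`. -/
def charPoly (M : Matroid α) [M.Finite] : ℤ[X] :=
  ∑ S ∈ M.groundFinset.powerset, (-1) ^ S.card * X ^ (M.rankNat - M.rkNat (S : Set α))

/-- The reduced characteristic polynomial
`∑_{S ⊆ E} (-1)^{#S} [rk M - rk S]_q`; it equals `χ_M(q) / (q - 1)` as soon as `E` is nonempty,
see `charPoly_eq_mul_redCharPoly`. -/
def redCharPoly (M : Matroid α) [M.Finite] : ℤ[X] :=
  ∑ S ∈ M.groundFinset.powerset, (-1) ^ S.card * qAnalogue (M.rankNat - M.rkNat (S : Set α))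

theorem charPoly_eq_mul_redCharPoly (M : Matroid α) [M.Finite] [M.Nonempty] :
    M.charPoly = (X - 1) * M.redCharPoly := by
  have h0 : (∑ S ∈ M.groundFinset.powerset, (-1 : ℤ[X]) ^ S.card) = 0 := by
    have h := Finset.sum_powerset_neg_one_pow_card_of_nonempty (x := M.groundFinset)
      (by simpa [groundFinset] using M.ground_nonempty)
    have h' := congrArg (Int.cast : ℤ → ℤ[X]) h
    push_cast at h'
    exact h'
  have h1 : (X - 1) * M.redCharPoly = M.charPoly
      - ∑ S ∈ M.groundFinset.powerset, (-1 : ℤ[X]) ^ S.card := by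
    rw [redCharPoly, charPoly, Finset.mul_sum, ← Finset.sum_sub_distrib]
    refine Finset.sum_congr rfl fun S _ ↦ ?_
    rw [mul_left_comm, qAnalogue, mul_geom_sum]
    ring
  rw [h1, h0, sub_zero]

/-! ### Initial matroids -/

/-- The `w`-weight `∑_{e ∈ B} w_e` of a set `B` (used for finite `B`). -/
def setWeight (w : α → ℝ) (B : Set α) : ℝ := ∑ᶠ e ∈ B, w e

/-- `B` is a base of `M` whose `w`-weight is maximal among the bases of `M`. -/
def IsMaxWeightBase (M : Matroid α) (w : α → ℝ) (B : Set α) : Prop :=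
  M.IsBase B ∧ ∀ B', M.IsBase B' → setWeight w B' ≤ setWeight w B

theorem IsBase.symm_exchange {M : Matroid α} {B₁ B₂ : Set α} (h₁ : M.IsBase B₁)
    (h₂ : M.IsBase B₂) {e : α} (he : e ∈ B₁ \ B₂) :
    ∃ f ∈ B₂ \ B₁, M.IsBase (insert f (B₁ \ {e})) ∧ M.IsBase (insert e (B₂ \ {f})) := by
  have heE := h₁.subset_ground he.1
  have hC := h₂.fundCircuit_isCircuit heE he.2
  have hK := fundCocircuit_isCocircuit he.1 h₁
  obtain ⟨f, ⟨hfC, hfK⟩, hfe⟩ := (hC.isCocircuit_inter_nontrivial hK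
    ⟨e, M.mem_fundCircuit _ _, M.mem_fundCocircuit _ _⟩).exists_ne e
  have hf2 : f ∈ B₂ := by simpa [hfe] using M.fundCircuit_subset_insert e B₂ hfC
  have hf1 : f ∈ M.E \ B₁ := by simpa [hfe] using M.fundCocircuit_subset_insert_compl e B₁ hfK
  refine ⟨f, ⟨hf2, hf1.2⟩, ?_, ?_⟩
  · rw [h₁.mem_fundCocircuit_iff_mem_fundCircuit,
      h₁.indep.mem_fundCircuit_iff (by rw [h₁.closure_eq]; exact hf1.1) hf1.2] at hfK
    rw [Set.insert_sdiff_singleton_comm hfe]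
    exact h₁.exchange_isBase_of_indep' he.1 hf1.2 hfK
  · rw [h₂.indep.mem_fundCircuit_iff (by rw [h₂.closure_eq]; exact heE) he.2] at hfC
    rw [Set.insert_sdiff_singleton_comm hfe.symm]
    exact h₂.exchange_isBase_of_indep' hf2 he.2 hfC

theorem setWeight_exchange (w : α → ℝ) {B : Set α} (hB : B.Finite) {e f : α} (he : e ∈ B)
    (hf : f ∉ B) : setWeight w (insert f (B \ {e})) = setWeight w B - w e + w f := by
  have h1 : setWeight w (insert f (B \ {e})) = w f + setWeight w (B \ {e}) :=
    finsum_mem_insert _ (fun h ↦ hf h.1) (hB.subset Set.sdiff_subset)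
  have h2 : setWeight w (insert e (B \ {e})) = w e + setWeight w (B \ {e}) :=
    finsum_mem_insert _ (fun h ↦ h.2 rfl) (hB.subset Set.sdiff_subset)
  rw [Set.insert_sdiff_singleton, Set.insert_eq_of_mem he] at h2
  linarith

theorem exists_isMaxWeightBase (M : Matroid α) [M.Finite] (w : α → ℝ) :
    ∃ B, M.IsMaxWeightBase w B := by
  have hfin : {B | M.IsBase B}.Finite :=
    M.ground_finite.finite_subsets.subset fun B hB ↦ IsBase.subset_ground hB
  obtain ⟨B, hB, hmax⟩ := Set.exists_max_image _ (setWeight w) hfin M.exists_isBase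
  exact ⟨B, hB, hmax⟩

theorem isMaxWeightBase_exchange (M : Matroid α) [M.Finite] (w : α → ℝ) :
    ExchangeProperty (M.IsMaxWeightBase w) := by
  intro B₁ B₂ h₁ h₂ e he
  obtain ⟨f, hf, hb₁, hb₂⟩ := h₁.1.symm_exchange h₂.1 he
  have e₁ := setWeight_exchange w h₁.1.finite he.1 hf.2
  have e₂ := setWeight_exchange w h₂.1.finite hf.1 he.2
  have i₂ := h₂.2 _ hb₂
  refine ⟨f, hf, hb₁, fun B' hB' ↦ ?_⟩
  have i₃ := h₁.2 _ hB'
  linarith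

/-- The initial matroid `M_w`: the matroid on the ground set of `M` whose bases are the bases of
`M` of maximal `w`-weight. -/
def initial (M : Matroid α) [M.Finite] (w : α → ℝ) : Matroid α :=
  Matroid.ofIsBaseOfFinite M.ground_finite (M.IsMaxWeightBase w) (M.exists_isMaxWeightBase w)
    (M.isMaxWeightBase_exchange w) (fun _ hB ↦ hB.1.subset_ground)

instance (M : Matroid α) [M.Finite] (w : α → ℝ) : (M.initial w).Finite := ⟨M.ground_finite⟩

/-! ### Flags of flats -/

/-- `𝓝(M)`: the set of flags (finite chains, possibly empty) of non-minimal flats of `M`. -/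
def flags (M : Matroid α) : Set (Finset (Set α)) :=
  {𝓕 | (∀ F ∈ 𝓕, M.IsFlat F ∧ F ≠ M.closure ∅) ∧ IsChain (· ⊆ ·) (𝓕 : Set (Set α))}

/-- `𝓝°(M)`: the flags of non-minimal flats that do not contain the ground set. -/
def properFlags (M : Matroid α) : Set (Finset (Set α)) :=
  {𝓕 | 𝓕 ∈ M.flags ∧ M.E ∉ 𝓕}

theorem flags_finite (M : Matroid α) [M.Finite] : M.flags.Finite := by
  have h : {F : Set α | F ⊆ M.E}.Finite := M.ground_finite.finite_subsets
  refine (h.toFinset.powerset.finite_toSet).subset fun 𝓕 h𝓕 ↦ ?_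
  simp only [Finset.coe_powerset, Set.mem_preimage, Set.mem_powerset_iff]
  intro F hF
  simpa using (h𝓕.1 F hF).1.subset_ground

theorem properFlags_finite (M : Matroid α) [M.Finite] : M.properFlags.Finite :=
  M.flags_finite.subset fun _ h ↦ h.1

/-- The vector `∑_{F ∈ 𝓕} k_F v_F`, where `v_F` is the indicator vector of `F`. For positive
coefficients `k` these vectors form the relative interior of the cone `σ_𝓕`. -/
def coneVector (𝓕 : Finset (Set α)) (k : Set α → ℝ) : α → ℝ :=
  fun e ↦ ∑ F ∈ 𝓕, k F * F.indicator 1 e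

/-- The matroid `M_𝓕`, that is `M_w` for `w` in the relative interior of the cone `σ_𝓕`. The
definition uses `w = ∑_{F ∈ 𝓕} v_F`; by `initial_coneVector` every other choice gives the same
matroid. -/
def initialFlag (M : Matroid α) [M.Finite] (𝓕 : Finset (Set α)) : Matroid α :=
  M.initial (coneVector 𝓕 fun _ ↦ 1)

instance (M : Matroid α) [M.Finite] (𝓕 : Finset (Set α)) : (M.initialFlag 𝓕).Finite :=
  inferInstanceAs (M.initial _).Finite

theorem exists_adapted_isBase (M : Matroid α) (𝓕 : Finset (Set α))
    (hE : ∀ F ∈ 𝓕, F ⊆ M.E) (hc : IsChain (· ⊆ ·) (𝓕 : Set (Set α))) :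
    ∃ B, M.IsBase B ∧ ∀ F ∈ 𝓕, M.IsBasis (B ∩ F) F := by
  have key : ∀ {I J F : Set α}, M.IsBasis (I ∩ F) F → I ⊆ J → M.Indep J →
      M.IsBasis (J ∩ F) F := by
    intro I J F hI hIJ hJ
    rw [← hI.eq_of_subset_indep (hJ.subset Set.inter_subset_left)
      (Set.inter_subset_inter_left _ hIJ) Set.inter_subset_right]
    exact hI
  suffices h : ∀ n : ℕ, ∀ 𝓖 : Finset (Set α), 𝓖 ⊆ 𝓕 → 𝓖.card = n →
      ∃ I, M.Indep I ∧ (∀ e ∈ I, ∃ F ∈ 𝓖, e ∈ F) ∧ ∀ F ∈ 𝓖, M.IsBasis (I ∩ F) F by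
    obtain ⟨I, hI, -, hIF⟩ := h _ 𝓕 subset_rfl rfl
    obtain ⟨B, hB, hIB⟩ := hI.exists_isBase_superset
    exact ⟨B, hB, fun F hF ↦ key (hIF F hF) hIB hB.indep⟩
  intro n
  induction n with
  | zero =>
    intro 𝓖 _ h0
    rw [Finset.card_eq_zero] at h0
    subst h0
    exact ⟨∅, M.empty_indep, by simp, by simp⟩
  | succ n ih =>
    classical
    intro 𝓖 h𝓖 hn
    have hne : 𝓖.Nonempty := by rw [← Finset.card_pos]; omega
    obtain ⟨F₀, hF₀, hmax⟩ := 𝓖.exists_maximal hne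
    have htop : ∀ F ∈ 𝓖, F ⊆ F₀ := by
      intro F hF
      rcases hc.total (h𝓖 hF) (h𝓖 hF₀) with h | h
      · exact h
      · exact hmax hF h
    obtain ⟨I, hI, hIs, hIF⟩ := ih (𝓖.erase F₀) ((Finset.erase_subset _ _).trans h𝓖)
      (by rw [Finset.card_erase_of_mem hF₀]; omega)
    have hI0 : I ⊆ F₀ := by
      intro e he
      obtain ⟨F, hF, heF⟩ := hIs e he
      exact htop F (Finset.mem_of_mem_erase hF) heF
    obtain ⟨J, hJ, hIJ⟩ := hI.subset_isBasis_of_subset hI0 (hE _ (h𝓖 hF₀))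
    refine ⟨J, hJ.indep, fun e he ↦ ⟨F₀, hF₀, hJ.subset he⟩, fun F hF ↦ ?_⟩
    by_cases h : F = F₀
    · subst h
      rwa [Set.inter_eq_self_of_subset_left hJ.subset]
    · exact key (hIF F (Finset.mem_erase.2 ⟨h, hF⟩)) hIJ hJ.indep

theorem setWeight_coneVector (𝓕 : Finset (Set α)) (k : Set α → ℝ) {B : Set α} (hB : B.Finite) :
    setWeight (coneVector 𝓕 k) B = ∑ F ∈ 𝓕, k F * ((B ∩ F).ncard : ℝ) := by
  classical
  obtain ⟨B, rfl⟩ := hB.exists_finset_coe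
  rw [setWeight, finsum_mem_coe_finset]
  simp only [coneVector]
  rw [Finset.sum_comm]
  refine Finset.sum_congr rfl fun F _ ↦ ?_
  rw [← Finset.mul_sum]
  congr 1
  have : ((B : Set α) ∩ F) = ((B.filter (· ∈ F) : Finset α) : Set α) := by
    ext; simp
  rw [this, Set.ncard_coe_finset, Finset.card_filter]
  push_cast
  exact Finset.sum_congr rfl fun e _ ↦ by simp [Set.indicator_apply]

theorem isMaxWeightBase_coneVector_iff (M : Matroid α) [M.Finite] {𝓕 : Finset (Set α)}
    (h𝓕 : 𝓕 ∈ M.flags) {k : Set α → ℝ} (hk : ∀ F ∈ 𝓕, 0 < k F) {B : Set α} :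
    M.IsMaxWeightBase (coneVector 𝓕 k) B ↔
      M.IsBase B ∧ ∀ F ∈ 𝓕, (B ∩ F).ncard = M.rkNat F := by
  obtain ⟨B₀, hB₀, hB₀F⟩ := M.exists_adapted_isBase 𝓕
    (fun F hF ↦ (h𝓕.1 F hF).1.subset_ground) h𝓕.2
  have hle : ∀ B', M.IsBase B' → ∀ F, (B' ∩ F).ncard ≤ M.rkNat F := by
    intro B' hB' F
    have h := (hB'.indep.subset (Set.inter_subset_left (t := F))).encard_le_eRk_of_subset
      Set.inter_subset_right
    exact ENat.toNat_le_toNat h (eRk_ne_top_iff.2 (RankFinite.isRkFinite F))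
  have h₀ : ∀ F ∈ 𝓕, (B₀ ∩ F).ncard = M.rkNat F := by
    intro F hF
    rw [rkNat, (hB₀F F hF).eRk_eq_encard, Set.ncard]
  constructor
  · rintro ⟨hB, hmax⟩
    refine ⟨hB, fun F hF ↦ ?_⟩
    have h := hmax _ hB₀
    rw [setWeight_coneVector _ _ hB.finite, setWeight_coneVector _ _ hB₀.finite] at h
    by_contra hne
    have hlt : (B ∩ F).ncard < M.rkNat F := lt_of_le_of_ne (hle B hB F) hne
    refine absurd h (not_le.2 (Finset.sum_lt_sum (fun G hG ↦ ?_) ⟨F, hF, ?_⟩))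
    · rw [h₀ G hG]
      exact mul_le_mul_of_nonneg_left (by exact_mod_cast hle B hB G) (hk G hG).le
    · rw [h₀ F hF]
      exact mul_lt_mul_of_pos_left (by exact_mod_cast hlt) (hk F hF)
  · rintro ⟨hB, hBF⟩
    refine ⟨hB, fun B' hB' ↦ ?_⟩
    rw [setWeight_coneVector _ _ hB.finite, setWeight_coneVector _ _ hB'.finite]
    refine Finset.sum_le_sum fun G hG ↦ ?_
    rw [hBF G hG]
    exact mul_le_mul_of_nonneg_left (by exact_mod_cast hle B' hB' G) (hk G hG).le

/-- `w ↦ M_w` is constant on the relative interior of `σ_𝓕`. -/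
theorem initial_coneVector (M : Matroid α) [M.Finite] {𝓕 : Finset (Set α)}
    (h𝓕 : 𝓕 ∈ M.flags) {k : Set α → ℝ} (hk : ∀ F ∈ 𝓕, 0 < k F) :
    M.initial (coneVector 𝓕 k) = M.initialFlag 𝓕 := by
  refine ext_isBase rfl fun B _ ↦ ?_
  exact (M.isMaxWeightBase_coneVector_iff h𝓕 hk).trans
    (M.isMaxWeightBase_coneVector_iff h𝓕 fun _ _ ↦ one_pos).symm

/-! ### Poincaré polynomials -/

open Classical in
/-- The finite set of all `𝓖 ∈ 𝓝°(M)` with `𝓖 ⊇ 𝓕`. -/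
def properFlagsAbove (M : Matroid α) [M.Finite] (𝓕 : Finset (Set α)) :
    Finset (Finset (Set α)) :=
  M.properFlags_finite.toFinset.filter (𝓕 ⊆ ·)

/-- The Poincaré polynomial of `M` at `𝓕`: the sum of the quotients
`χ̄_{M_𝓖}(q) / (q - 1)^{#𝓖}` over all `𝓖 ∈ 𝓝°(M)` with `𝓖 ⊇ 𝓕`. The quotient is taken in `ℤ[q]` by
division with remainder by a monic polynomial. -/
def poincarePoly (M : Matroid α) [M.Finite] (𝓕 : Finset (Set α)) : ℤ[X] :=
  ∑ 𝓖 ∈ M.properFlagsAbove 𝓕, (M.initialFlag 𝓖).redCharPoly /ₘ (X - 1) ^ 𝓖.card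

end Matroid

end

/-! Flags are chains of flats, and `initialFlag_insert` peels off the largest member `K`: the
initial matroid is that of the smaller flag on `M ↾ K`, plus `M ／ K` as a direct summand.
Characteristic polynomials multiply over direct sums, so reduced ones multiply up to one extra
factor `q - 1`. Induction gives the divisibility, and shows that each quotient is the product of the
reduced characteristic polynomials `a(F, G)` of the minors `(M ↾ G) ／ F` along the steps of the
chain from the minimal flat to `E`. The Poincaré polynomial is therefore a weighted sum over chains
of flats through `𝓕`.

Palindromicity comes from the theory of kernels of Kazhdan–Lusztig–Stanley type. The matrix `1 + (q
- 1) a` of characteristic polynomials is the Möbius matrix times a `q`-twisted zeta matrix, hence is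
inverse to its own `q`-reversal. With `b` the reversal of `a`, this reads `a - b = (q - 1) a b`
(`sub_reversal_eq`). Let `A`, `B` keep only the entries at steps that skip no member of `𝓕`. Then `A
- B = A V B`, where `V` is diagonal, `q - 1` off `𝓕` and `0` on it (`stepMatrix_sub_eq`).

Let `u G` be the Poincaré polynomial of `M ↾ G` and `e` the unit vector at the bottom. The recursion
`u = (e + u) A` (`poincarePoly_restrict_eq_sum`) becomes `u = e B + u (1 + V) B`: a chain sum for
`b` in which an interior flat has weight `1` on `𝓕` and `q` elsewhere. The `q`-reversal of `u` obeys
the same recursion, so the two agree (`invert_chainSum`). On exponents: a chain with `k` interior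
flats contributes `rk M - 1 - k` from the reversed steps and `k - #𝓕` from the weights, in total `rk
M - 1 - #𝓕`. -/

namespace Matroid

/-! ### Kernels of ranked posets and palindromic chain sums -/

section Kernel

open LaurentPolynomial Matrix

variable {L : Type*} [PartialOrder L] [Fintype L] [DecidableEq L]

/-- The zeta matrix of a finite poset. -/
noncomputable def zetaMatrix (L : Type*) [PartialOrder L] (R : Type*) [Zero R] [One R] :
    Matrix L L R :=
  open Classical in Matrix.of fun F G ↦ if F ≤ G then 1 else 0

/-- The `q`-reversal of a matrix indexed by a ranked poset:
`b(F, G) = q ^ (ρ(G) - ρ(F) - 1) a(F, G)(q⁻¹)`. -/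
noncomputable def reversal (ρ : L → ℤ) (a : Matrix L L ℤ[T;T⁻¹]) : Matrix L L ℤ[T;T⁻¹] :=
  Matrix.of fun F G ↦ T (ρ G - ρ F - 1) * invert (a F G)

theorem isLeftRegular_T_one_sub_one : IsLeftRegular (T 1 - 1 : ℤ[T;T⁻¹]) := by
  have : NoZeroDivisors ℤ[T;T⁻¹] := inferInstanceAs (NoZeroDivisors (AddMonoidAlgebra ℤ ℤ))
  have h : (T 1 - 1 : ℤ[T;T⁻¹]) ≠ 0 := by
    rw [← toLaurent_X, ← toLaurent_one, ← map_sub]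
    exact toLaurent_ne_zero.2 (X_sub_C_ne_zero 1)
  exact fun x y hxy ↦ sub_eq_zero.1
    ((mul_eq_zero.1 (by simpa [mul_sub, sub_eq_zero] using hxy)).resolve_left h)

/-- If `1 + (q - 1) a` is the characteristic kernel of a ranked poset, then `a` and its reversal
`b` satisfy `a - b = (q - 1) a b`. -/
theorem sub_reversal_eq (ρ : L → ℤ) (m : Matrix L L ℤ) (hm : m * zetaMatrix L ℤ = 1)
    (a : Matrix L L ℤ[T;T⁻¹])
    (ha : ∀ F G, (1 + (T 1 - 1 : ℤ[T;T⁻¹]) • a) F G =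
      ∑ H, (m F H : ℤ[T;T⁻¹]) * (zetaMatrix L ℤ[T;T⁻¹] H G * T (ρ G - ρ H))) :
    a - reversal ρ a = (T 1 - 1 : ℤ[T;T⁻¹]) • (a * reversal ρ a) := by
  classical
  set q : ℤ[T;T⁻¹] := T 1 with hq
  set b := reversal ρ a with hb
  set m' : Matrix L L ℤ[T;T⁻¹] := m.map (Int.castRingHom _) with hm'
  set z := zetaMatrix L ℤ[T;T⁻¹] with hz
  have hzm : z = (zetaMatrix L ℤ).map (Int.castRingHom _) := by
    ext1 F G
    simp only [hz, zetaMatrix, Matrix.of_apply, Matrix.map_apply]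
    split_ifs <;> simp
  have hmz : m' * z = 1 := by
    rw [hzm, hm', ← Matrix.map_mul, hm, Matrix.map_one _ (map_zero _) (map_one _)]
  have hz' : z * m' = 1 := mul_eq_one_comm.1 hmz
  set D : Matrix L L ℤ[T;T⁻¹] := diagonal fun F ↦ T (ρ F) with hD
  set D' : Matrix L L ℤ[T;T⁻¹] := diagonal fun F ↦ T (-ρ F) with hD'
  have hDD : D * D' = 1 := by
    rw [hD, hD', Matrix.diagonal_mul_diagonal, ← Matrix.diagonal_one]
    congr 1
    ext1 F
    rw [← T_add, add_neg_cancel, T_zero]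
  have hDD' : D' * D = 1 := mul_eq_one_comm.1 hDD
  -- Conjugating the zeta matrix by the diagonal of powers `q ^ ρ` produces the entries `q ^ (ρ G -
  -- ρ H)`.
  have h1 : 1 + (q - 1) • a = m' * D' * z * D := by
    ext1 F G
    rw [ha, hD, Matrix.mul_diagonal, Matrix.mul_apply, Finset.sum_mul]
    refine Finset.sum_congr rfl fun H _ ↦ ?_
    rw [hD', Matrix.mul_diagonal, sub_eq_neg_add, T_add]
    simp only [hm', Matrix.map_apply, eq_intCast]
    ring
  -- Substituting `q⁻¹` and scaling by `q ^ (ρ G - ρ F)` moves the conjugation from the zeta to the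
  -- Möbius factor. Since `q (q⁻¹ - 1) = -(q - 1)`, the shift by `-1` in the reversal accounts for
  -- the sign on the left.
  have h2 : 1 - (q - 1) • b = D' * m' * D * z := by
    ext1 F G
    have h := congrArg (fun p ↦ T (ρ G - ρ F) * invert p) (ha F G)
    simp only [map_sum, map_mul, map_intCast, invert_T] at h
    have hl : T (ρ G - ρ F) * invert ((1 + (q - 1) • a) F G) = (1 - (q - 1) • b) F G := by
      rw [Matrix.add_apply, Matrix.sub_apply, Matrix.smul_apply, Matrix.smul_apply, hb, reversal,
        Matrix.of_apply, smul_eq_mul, smul_eq_mul, map_add, map_mul, map_sub, map_one, hq,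
        invert_T, mul_add, T_sub (ρ G - ρ F) 1]
      have hinv : (T 1 : ℤ[T;T⁻¹]) * T (-1) = 1 := by rw [← T_add]; simp
      have hdiag : T (ρ G - ρ F) * invert ((1 : Matrix L L ℤ[T;T⁻¹]) F G)
          = (1 : Matrix L L ℤ[T;T⁻¹]) F G := by
        by_cases h : F = G
        · subst h; simp
        · simp [h]
      rw [hdiag]
      linear_combination (T (ρ G - ρ F) * invert (a F G)) * hinv
    rw [← hl, h, Matrix.mul_apply, Finset.mul_sum]
    refine Finset.sum_congr rfl fun H _ ↦ ?_
    have hzi : invert (zetaMatrix L ℤ[T;T⁻¹] H G) = z H G := by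
      simp only [hz, zetaMatrix, Matrix.of_apply]
      split_ifs <;> simp
    rw [hzi, hD, Matrix.mul_diagonal, hD', Matrix.diagonal_mul]
    have : (T (ρ G - ρ F) : ℤ[T;T⁻¹]) * T (-(ρ G - ρ H)) = T (-ρ F) * T (ρ H) := by
      rw [← T_add, ← T_add]; congr 1; ring
    simp only [hm', Matrix.map_apply, eq_intCast]
    linear_combination (m F H : ℤ[T;T⁻¹]) * z H G * this
  have h3 : (1 + (q - 1) • a) * (1 - (q - 1) • b) = 1 := by
    rw [h1, h2]
    calc m' * D' * z * D * (D' * m' * D * z)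
        = m' * D' * z * (D * D') * m' * D * z := by simp only [Matrix.mul_assoc]
      _ = m' * D' * (z * m') * D * z := by rw [hDD]; simp only [Matrix.mul_assoc, Matrix.one_mul]
      _ = m' * (D' * D) * z := by rw [hz']; simp only [Matrix.mul_assoc, Matrix.one_mul]
      _ = 1 := by rw [hDD', Matrix.mul_one, hmz]
  have h4 : (q - 1) • (a - b) = (q - 1) • ((q - 1) • (a * b)) := by
    have : (1 + (q - 1) • a) * (1 - (q - 1) • b)
        = 1 + (q - 1) • (a - b) - (q - 1) • ((q - 1) • (a * b)) := by
      rw [add_mul, mul_sub, mul_sub, one_mul, one_mul, mul_one, smul_mul_smul_comm, smul_sub,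
        smul_smul]
      abel
    rw [this] at h3
    have h5 := congrArg (fun x ↦ x - 1) h3
    simp only [sub_self] at h5
    rw [← sub_eq_zero, ← h5]
    abel
  ext1 F G
  have := congrFun (congrFun h4 F) G
  simp only [Matrix.smul_apply, smul_eq_mul] at this
  simpa [Matrix.smul_apply] using isLeftRegular_T_one_sub_one this

/-- `(K, T)` is a possible step in a chain through all elements of `𝓕` below the top of the
chain. -/
def IsStep (𝓕 : Finset L) (K G : L) : Prop := K < G ∧ ∀ F ∈ 𝓕, F < G → F ≤ K

open Classical in
/-- The part of a matrix supported on the steps of chains through `𝓕`. -/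
noncomputable def stepMatrix (𝓕 : Finset L) (a : Matrix L L ℤ[T;T⁻¹]) : Matrix L L ℤ[T;T⁻¹] :=
  Matrix.of fun K G ↦ if IsStep 𝓕 K G then a K G else 0

/-- An element strictly inside a step lies outside `𝓕` and cuts the step into two steps; conversely,
two steps that meet outside `𝓕` compose to a step. The zeros of the diagonal matrix discard the
products that meet in `𝓕`. -/
theorem stepMatrix_sub_eq (𝓕 : Finset L) {a b : Matrix L L ℤ[T;T⁻¹]} {q : ℤ[T;T⁻¹]}
    (ha : ∀ F G, ¬ F < G → a F G = 0) (hb : ∀ F G, ¬ F < G → b F G = 0)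
    (hab : a - b = (q - 1) • (a * b)) :
    stepMatrix 𝓕 a - stepMatrix 𝓕 b =
      stepMatrix 𝓕 a * diagonal (fun F ↦ if F ∈ 𝓕 then 0 else q - 1) * stepMatrix 𝓕 b := by
  classical
  ext1 F G
  rw [Matrix.mul_apply]
  simp only [Matrix.mul_diagonal, Matrix.sub_apply]
  by_cases hFG : IsStep 𝓕 F G
  · have h := congrFun (congrFun hab F) G
    rw [Matrix.sub_apply, Matrix.smul_apply, Matrix.mul_apply, smul_eq_mul, Finset.mul_sum] at h
    simp only [stepMatrix, Matrix.of_apply, if_pos hFG, h]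
    refine Finset.sum_congr rfl fun K _ ↦ ?_
    by_cases hK : F < K ∧ K < G
    · have h1 : IsStep 𝓕 F K := ⟨hK.1, fun A hA h ↦ hFG.2 A hA (h.trans hK.2)⟩
      have h2 : IsStep 𝓕 K G := ⟨hK.2, fun A hA h ↦ (hFG.2 A hA h).trans hK.1.le⟩
      have h3 : K ∉ 𝓕 := fun h ↦ (hFG.2 K h hK.2).not_gt hK.1
      rw [if_pos h1, if_pos h2, if_neg h3]
      ring
    · rcases not_and_or.1 hK with h | h
      · simp [ha F K h]
      · simp [hb K G h]
  · simp only [stepMatrix, Matrix.of_apply, if_neg hFG, sub_self]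
    symm
    refine Finset.sum_eq_zero fun K _ ↦ ?_
    by_cases hK : K ∈ 𝓕
    · simp [hK]
    by_cases h1 : IsStep 𝓕 F K
    · by_cases h2 : IsStep 𝓕 K G
      · refine absurd ⟨h1.1.trans h2.1, fun A hA h ↦ ?_⟩ hFG
        exact h1.2 A hA ((h2.2 A hA h).lt_of_ne (fun h ↦ hK (h ▸ hA)))
      · simp [h2]
    · simp [h1]

open Classical in
/-- The weighted chain sums through `𝓕` from the bottom of a ranked poset are palindromic if the
weights satisfy `a - b = (q - 1) a b` for the reversal `b`. -/
theorem invert_chainSum [OrderBot L] (ρ : L → ℤ) (𝓕 : Finset L) (h𝓕 : ⊥ ∉ 𝓕)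
    (a : Matrix L L ℤ[T;T⁻¹]) (ha : ∀ F G, ¬ F < G → a F G = 0)
    (hab : a - reversal ρ a = (T 1 - 1 : ℤ[T;T⁻¹]) • (a * reversal ρ a)) (u : L → ℤ[T;T⁻¹])
    (hu : ∀ G, u G = ∑ K with IsStep 𝓕 K G, (if K = ⊥ then 1 else u K) * a K G) (G : L) :
    invert (u G) = T (-(ρ G - ρ ⊥ - 1 - ((𝓕.filter (· < G)).card : ℤ))) * u G := by
  set q : ℤ[T;T⁻¹] := T 1 with hq
  set b := reversal ρ a with hb
  have hb0 : ∀ F G, ¬ F < G → b F G = 0 := fun F G h ↦ by simp [hb, reversal, ha F G h]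
  set A := stepMatrix 𝓕 a with hA
  set B := stepMatrix 𝓕 b with hB
  have hAB := stepMatrix_sub_eq 𝓕 ha hb0 hab
  rw [← hA, ← hB] at hAB
  set V : Matrix L L ℤ[T;T⁻¹] := diagonal fun F ↦ if F ∈ 𝓕 then 0 else q - 1 with hV
  set e : L → ℤ[T;T⁻¹] := Pi.single ⊥ 1 with he
  -- No step ends at the bottom. Hence `e + u` takes the value `1` there, as the case distinction in
  -- `hu` requires.
  have hub : u ⊥ = 0 := by
    rw [hu, Finset.filter_false_of_mem, Finset.sum_empty]
    exact fun K _ h ↦ not_lt_bot h.1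
  have hstep : ∀ G : L, IsStep 𝓕 ⊥ G → 𝓕.filter (· < G) = ∅ := by
    refine fun G hG ↦ Finset.filter_false_of_mem fun F hF h ↦ h𝓕 ?_
    rwa [← le_bot_iff.1 (hG.2 F hF h)]
  have hu1 : u = (e + u) ᵥ* A := by
    ext1 G
    rw [hu, Matrix.vecMul, dotProduct, Finset.sum_filter]
    refine Finset.sum_congr rfl fun K _ ↦ ?_
    simp only [hA, stepMatrix, Matrix.of_apply]
    split_ifs with h1 h2
    · subst h2; simp [he, hub]
    · simp [he, h2]
    · simp
  -- Multiply `u = (e + u) A` on the right by `1 - V B` and use `A (1 - V B) = B`.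
  have hu2 : u = e ᵥ* B + u ᵥ* ((1 + V) * B) := by
    have h1 : A - A * V * B = (1 : Matrix L L ℤ[T;T⁻¹]) * B := by
      rw [← hAB]; simp
    have h2 : u - u ᵥ* (V * B) = (e + u) ᵥ* B := by
      conv_lhs => rw [hu1]
      rw [Matrix.vecMul_vecMul, ← Matrix.vecMul_sub, ← Matrix.mul_assoc, h1, Matrix.one_mul]
    rw [Matrix.add_mul, Matrix.one_mul, Matrix.vecMul_add]
    rw [Matrix.add_vecMul] at h2
    rw [sub_eq_iff_eq_add] at h2
    rw [← add_assoc]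
    exact h2
  set n : L → ℤ := fun G ↦ ((𝓕.filter (· < G)).card : ℤ) with hn
  -- The left side is the `q`-reversal of `u`; it is shown to satisfy the recursion `hu2G`, which
  -- determines `u` from the values below `G`.
  suffices h : T (ρ G - ρ ⊥ - 1 - n G) * invert (u G) = u G by
    conv_rhs => rw [← h]
    rw [← mul_assoc, ← T_add, neg_add_cancel, T_zero, one_mul]
  have hu2G : ∀ G, u G = ∑ K with IsStep 𝓕 K G,
      (if K = ⊥ then 1 else (if K ∈ 𝓕 then 1 else q) * u K) * b K G := by
    intro G
    conv_lhs => rw [hu2]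
    rw [Pi.add_apply, ← Matrix.vecMul_vecMul, ← Pi.add_apply, ← Matrix.add_vecMul,
      Matrix.vecMul, dotProduct, Finset.sum_filter]
    refine Finset.sum_congr rfl fun K _ ↦ ?_
    rw [Pi.add_apply, Matrix.vecMul_add, Matrix.vecMul_one, Pi.add_apply, hV,
      Matrix.vecMul_diagonal]
    simp only [hB, stepMatrix, Matrix.of_apply]
    by_cases hs : IsStep 𝓕 K G
    · rw [if_pos hs, if_pos hs]
      by_cases hK : K = ⊥
      · subst hK; simp [he, hub]
      · rw [if_neg hK, he, Pi.single_eq_of_ne hK]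
        split_ifs <;> ring
    · rw [if_neg hs, if_neg hs, mul_zero]
  induction G using WellFoundedLT.induction with
  | ind G ih =>
    refine Eq.trans ?_ (hu2G G).symm
    rw [hu G, map_sum, Finset.mul_sum]
    refine Finset.sum_congr rfl fun K hK ↦ ?_
    replace hK : IsStep 𝓕 K G := by simpa using hK
    have hbK : b K G = T (ρ G - ρ K - 1) * invert (a K G) := rfl
    rw [hbK]
    split_ifs with h1 h2
    · subst h1
      simp [hn, hstep G hK]
    -- Leaving a member `K` of `𝓕` raises the count by one, which uses up the power of `q` that any
    -- other interior element contributes; so the weight of `K` is `1` here and `q` in the last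
    -- case.
    · have hcard : n G = n K + 1 := by
        have : 𝓕.filter (· < G) = insert K (𝓕.filter (· < K)) := by
          ext F
          simp only [Finset.mem_filter, Finset.mem_insert]
          constructor
          · rintro ⟨hF, hFG⟩
            exact (hK.2 F hF hFG).eq_or_lt.imp id fun h ↦ ⟨hF, h⟩
          · rintro (rfl | ⟨hF, hFK⟩)
            · exact ⟨h2, hK.1⟩
            · exact ⟨hF, hFK.trans hK.1⟩
        simp only [hn]
        rw [this, Finset.card_insert_of_notMem (by simp)]
        push_cast; rfl
      rw [map_mul, hcard]
      have : (T (ρ G - ρ ⊥ - 1 - (n K + 1)) : ℤ[T;T⁻¹])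
          = T (ρ K - ρ ⊥ - 1 - n K) * T (ρ G - ρ K - 1) := by
        rw [← T_add]; congr 1; ring
      rw [this]
      linear_combination (T (ρ G - ρ K - 1) * invert (a K G)) * ih K hK.1
    · have hcard : n G = n K := by
        simp only [hn]
        congr 2
        ext F
        simp only [Finset.mem_filter]
        refine and_congr_right fun hF ↦ ⟨fun h ↦ ?_, fun h ↦ h.trans hK.1⟩
        exact (hK.2 F hF h).lt_of_ne fun h ↦ h2 (h ▸ hF)
      rw [map_mul, hcard]
      have : (T (ρ G - ρ ⊥ - 1 - n K) : ℤ[T;T⁻¹])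
          = q * T (ρ K - ρ ⊥ - 1 - n K) * T (ρ G - ρ K - 1) := by
        rw [hq, ← T_add, ← T_add]; congr 1; ring
      rw [this]
      linear_combination (q * T (ρ G - ρ K - 1) * invert (a K G)) * ih K hK.1

end Kernel

/-! ### Ranks of minors and direct sums; multiplicativity of the characteristic polynomial -/

section Rank

variable {α : Type*}

theorem cast_rkNat (M : Matroid α) [M.RankFinite] (X : Set α) : (M.rkNat X : ℕ∞) = M.eRk X :=
  ENat.natCast_toNat (eRk_ne_top_iff.2 (RankFinite.isRkFinite X))

theorem rkNat_mono (M : Matroid α) [M.RankFinite] {X Y : Set α} (h : X ⊆ Y) :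
    M.rkNat X ≤ M.rkNat Y := by
  have := M.eRk_mono h
  rw [← cast_rkNat, ← cast_rkNat] at this
  exact_mod_cast this

theorem rkNat_closure (M : Matroid α) (X : Set α) : M.rkNat (M.closure X) = M.rkNat X := by
  rw [rkNat, eRk_closure_eq, rkNat]

theorem rkNat_restrict (M : Matroid α) {R X : Set α} (h : X ⊆ R) :
    (M ↾ R).rkNat X = M.rkNat X := by
  rw [rkNat, restrict_eRk_eq _ h, rkNat]

/-- A basis of `X ∪ C` that extends a basis of `C` meets `C` in exactly that basis, and its part
outside `C` is a basis in the contraction. -/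
theorem eRk_contract_add (M : Matroid α) (C X : Set α) :
    (M ／ C).eRk X + M.eRk C = M.eRk (X ∪ C) := by
  obtain ⟨I, hI⟩ := M.exists_isBasis' C
  obtain ⟨J, hJ, hIJ⟩ := hI.indep.subset_isBasis'_of_subset (hI.subset.trans
    (Set.subset_union_right (s := X)))
  have hJC : J ∩ C = I := (hI.eq_of_subset_indep (hJ.indep.inter_right C)
    (Set.subset_inter hIJ hI.subset) Set.inter_subset_right).symm
  have hd : J \ C ∪ I = J := by rw [← hJC, Set.sdiff_union_inter]
  have h := hJ.contract_isBasis' hI (by rw [hd]; exact hJ.indep)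
  have hX : (M ／ C).eRk X = (M ／ C).eRk ((X ∪ C) \ C) := by
    rw [Set.union_sdiff_right, ← eRk_inter_ground, ← eRk_inter_ground _ (X \ C), contract_ground]
    congr 1
    ext; simp; tauto
  rw [hX, h.eRk_eq_encard, hI.eRk_eq_encard, hJ.eRk_eq_encard,
    ← Set.encard_union_eq (Set.disjoint_left.2 fun x hx hxI ↦ hx.2 (hI.subset hxI)), hd]

theorem rkNat_contract_add (M : Matroid α) [M.RankFinite] (C X : Set α) :
    (M ／ C).rkNat X + M.rkNat C = M.rkNat (X ∪ C) := by
  have := M.eRk_contract_add C X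
  rw [← cast_rkNat, ← cast_rkNat, ← cast_rkNat] at this
  exact_mod_cast this

theorem eRk_disjointSum {M N : Matroid α} (h : Disjoint M.E N.E) {X : Set α}
    (hX : X ⊆ M.E ∪ N.E) :
    (M.disjointSum N h).eRk X = M.eRk (X ∩ M.E) + N.eRk (X ∩ N.E) := by
  obtain ⟨I, hI⟩ := (M.disjointSum N h).exists_isBasis X (by simpa using hX)
  rw [hI.eRk_eq_encard]
  rw [disjointSum_isBasis_iff] at hI
  rw [hI.1.eRk_eq_encard, hI.2.1.eRk_eq_encard, ← Set.encard_union_eq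
    (h.mono Set.inter_subset_right Set.inter_subset_right), ← Set.inter_union_distrib_left,
    Set.inter_eq_self_of_subset_left (hI.2.2.1.trans hX)]

instance (M N : Matroid α) [M.Finite] [N.Finite] (h : Disjoint M.E N.E) :
    (M.disjointSum N h).Finite :=
  ⟨by rw [disjointSum_ground_eq]; exact M.ground_finite.union N.ground_finite⟩

theorem rkNat_disjointSum {M N : Matroid α} [M.Finite] [N.Finite] (h : Disjoint M.E N.E)
    {X : Set α} (hX : X ⊆ M.E ∪ N.E) :
    (M.disjointSum N h).rkNat X = M.rkNat (X ∩ M.E) + N.rkNat (X ∩ N.E) := by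
  have := eRk_disjointSum h hX
  rw [← cast_rkNat, ← cast_rkNat, ← cast_rkNat] at this
  exact_mod_cast this

@[simp] theorem coe_groundFinset (M : Matroid α) [M.Finite] : (M.groundFinset : Set α) = M.E := by
  simp [groundFinset]

theorem mem_powerset_groundFinset {M : Matroid α} [M.Finite] {S : Finset α} :
    S ∈ M.groundFinset.powerset ↔ (S : Set α) ⊆ M.E := by
  rw [Finset.mem_powerset, ← Finset.coe_subset, coe_groundFinset]

theorem charPoly_disjointSum {M N : Matroid α} [M.Finite] [N.Finite] (h : Disjoint M.E N.E) :
    (M.disjointSum N h).charPoly = M.charPoly * N.charPoly := by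
  classical
  rw [charPoly, charPoly, charPoly, Finset.sum_mul_sum, ← Finset.sum_product']
  refine Finset.sum_nbij' (fun S ↦ (S ∩ M.groundFinset, S ∩ N.groundFinset))
    (fun S ↦ S.1 ∪ S.2) ?_ ?_ ?_ ?_ ?_
  · intro S _
    simp
  · rintro ⟨S, S'⟩ hS
    rw [Finset.mem_product, mem_powerset_groundFinset, mem_powerset_groundFinset] at hS
    rw [mem_powerset_groundFinset, disjointSum_ground_eq, Finset.coe_union]
    exact Set.union_subset_union hS.1 hS.2
  · intro S hS
    rw [mem_powerset_groundFinset, disjointSum_ground_eq] at hS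
    rw [← Finset.coe_inj]
    simp [← Set.inter_union_distrib_left, Set.inter_eq_self_of_subset_left hS]
  · rintro ⟨S, S'⟩ hS
    rw [Finset.mem_product, mem_powerset_groundFinset, mem_powerset_groundFinset] at hS
    simp only [Prod.mk.injEq, ← Finset.coe_inj, Finset.coe_inter, Finset.coe_union,
      coe_groundFinset, Set.union_inter_distrib_right]
    rw [(h.mono_left hS.1).inter_eq, (h.symm.mono_left hS.2).inter_eq,
      Set.inter_eq_self_of_subset_left hS.1, Set.inter_eq_self_of_subset_left hS.2]
    simp
  · intro S hS
    rw [mem_powerset_groundFinset, disjointSum_ground_eq] at hS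
    have hcard : S.card = (S ∩ M.groundFinset).card + (S ∩ N.groundFinset).card := by
      rw [← Finset.card_union_of_disjoint]
      · congr 1
        rw [← Finset.coe_inj]
        simp [← Set.inter_union_distrib_left, Set.inter_eq_self_of_subset_left hS]
      · rw [← Finset.disjoint_coe]
        simpa using h.mono Set.inter_subset_right Set.inter_subset_right
    -- These bounds let the truncated difference of sums split into a sum of differences.
    have h1 := M.rkNat_mono (X := S ∩ M.E) Set.inter_subset_right
    have h2 := N.rkNat_mono (X := S ∩ N.E) Set.inter_subset_right
    have hr : (M.disjointSum N h).rankNat - (M.disjointSum N h).rkNat S =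
        (M.rankNat - M.rkNat (S ∩ M.E)) + (N.rankNat - N.rkNat (S ∩ N.E)) := by
      rw [rankNat, rkNat_disjointSum h hS, rkNat_disjointSum h (by simp),
        disjointSum_ground_eq, rankNat, rankNat, Set.inter_eq_self_of_subset_right
        Set.subset_union_left, Set.inter_eq_self_of_subset_right Set.subset_union_right]
      omega
    simp only [Finset.coe_inter, coe_groundFinset]
    rw [hr, hcard, pow_add, pow_add]
    ring

end Rank

/-! ### Möbius inversion on the lattice of flats -/

section Minor

variable {α : Type*}

instance (M : Matroid α) [M.Finite] (G : {F // M.IsFlat F}) : (M ↾ (G : Set α)).Finite :=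
  ⟨M.ground_finite.subset G.2.subset_ground⟩

instance (M : Matroid α) [M.Finite] : Finite {F // M.IsFlat F} :=
  (M.ground_finite.finite_subsets.subset fun _ h ↦ IsFlat.subset_ground h).to_subtype

noncomputable instance (M : Matroid α) [M.Finite] : Fintype {F // M.IsFlat F} :=
  Fintype.ofFinite _

/-- The Möbius function of the lattice of flats, as the sum of `(-1) ^ #S` over all sets `S`
disjoint from `F` such that `S ∪ F` spans `H`. -/
noncomputable def flatMoebius (M : Matroid α) [M.Finite] :
    Matrix {F // M.IsFlat F} {F // M.IsFlat F} ℤ :=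
  open Classical in Matrix.of fun F H ↦
    ∑ S ∈ M.groundFinset.powerset.filter fun S : Finset α ↦
      Disjoint (S : Set α) F ∧ M.closure (S ∪ F) = H, (-1) ^ S.card

-- Grouping the subsets `S` of `G \ F` by the flat spanned by `S ∪ F` turns a Möbius sum over flats
-- into an alternating sum over sets. The weight `f` is arbitrary because two choices are needed: a
-- constant for Möbius inversion and a power of `q` for characteristic polynomials.
open Classical in
theorem sum_flatMoebius {R : Type*} [CommRing R] (M : Matroid α) [M.Finite]
    (F G : {F // M.IsFlat F}) (f : Set α → R) :
    ∑ H : {F // M.IsFlat F}, (M.flatMoebius F H : R) *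
      (zetaMatrix {F // M.IsFlat F} R H G * f H) =
    if F ≤ G then ∑ S ∈ ((M ↾ (G : Set α)) ／ (F : Set α)).groundFinset.powerset,
      (-1) ^ S.card * f (M.closure (S ∪ F)) else 0 := by
  have h1 : ∀ H : {F // M.IsFlat F}, (M.flatMoebius F H : R) *
      (zetaMatrix {F // M.IsFlat F} R H G * f H) =
      ∑ S ∈ M.groundFinset.powerset.filter fun S : Finset α ↦
          Disjoint (S : Set α) F ∧ M.closure (S ∪ F) ⊆ G,
        if M.closure (S ∪ F) = H then (-1) ^ S.card * f (M.closure (S ∪ F)) else 0 := by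
    intro H
    rw [flatMoebius, Matrix.of_apply, Int.cast_sum, Finset.sum_mul, Finset.sum_filter,
      Finset.sum_filter]
    refine Finset.sum_congr rfl fun S _ ↦ ?_
    rw [zetaMatrix, Matrix.of_apply]
    have hHG : H ≤ G ↔ (H : Set α) ⊆ G := Iff.rfl
    by_cases hS : Disjoint (S : Set α) F
    · by_cases hH : M.closure (S ∪ F) = H
      · by_cases hG : (H : Set α) ⊆ G
        · simp [hS, hH, hHG, hG]
        · simp [hS, hH, hHG, hG]
      · simp [hH]
    · simp [hS]
  rw [Finset.sum_congr rfl fun H _ ↦ h1 H, Finset.sum_comm]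
  have h2 : ∀ S : Finset α, (∑ H : {F // M.IsFlat F},
      if M.closure (S ∪ F) = H then (-1) ^ S.card * f (M.closure (S ∪ F)) else 0) =
      (-1) ^ S.card * f (M.closure (S ∪ F)) := by
    intro S
    rw [Finset.sum_eq_single ⟨M.closure (S ∪ F), M.isFlat_closure _⟩]
    · simp
    · intro H _ hH
      rw [if_neg]
      exact fun h ↦ hH (Subtype.ext h.symm)
    · simp
  rw [Finset.sum_congr rfl fun S _ ↦ h2 S]
  have hsub : ∀ S : Finset α, (S : Set α) ⊆ M.E →
      (M.closure (S ∪ F) ⊆ (G : Set α) ↔ (S : Set α) ⊆ G ∧ F ≤ G) := by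
    intro S hS
    have hSF : (S : Set α) ∪ F ⊆ M.E := Set.union_subset hS F.2.subset_ground
    refine Iff.trans ⟨(M.subset_closure _ hSF).trans, fun h ↦ ?_⟩ Set.union_subset_iff
    exact (M.closure_subset_closure h).trans_eq G.2.closure
  split_ifs with hFG
  · refine Finset.sum_congr ?_ fun _ _ ↦ rfl
    ext S
    rw [Finset.mem_filter, mem_powerset_groundFinset, mem_powerset_groundFinset, contract_ground,
      restrict_ground_eq, Set.subset_sdiff]
    constructor
    · rintro ⟨hS, hd, hc⟩
      exact ⟨((hsub S hS).1 hc).1, hd⟩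
    · rintro ⟨hS, hd⟩
      have hSE := hS.trans G.2.subset_ground
      exact ⟨hSE, hd, (hsub S hSE).2 ⟨hS, hFG⟩⟩
  · refine Finset.sum_eq_zero fun S hS ↦ ?_
    rw [Finset.mem_filter, mem_powerset_groundFinset] at hS
    exact absurd ((hsub S hS.1).1 hS.2.2).2 hFG

/-- For `F ≤ G` the entry is the alternating sum over all subsets of `G \ F`, which vanishes unless
that set is empty. -/
theorem flatMoebius_mul_zeta (M : Matroid α) [M.Finite] [DecidableEq {F // M.IsFlat F}] :
    M.flatMoebius * zetaMatrix {F // M.IsFlat F} ℤ = 1 := by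
  classical
  ext1 F G
  have h := M.sum_flatMoebius (R := ℤ) F G fun _ ↦ 1
  simp only [mul_one, Int.cast_id] at h
  rw [Matrix.mul_apply, h, Finset.sum_powerset_neg_one_pow_card, Matrix.one_apply, ← ite_and]
  refine if_congr ?_ rfl rfl
  rw [← Finset.coe_eq_empty, coe_groundFinset, contract_ground, restrict_ground_eq,
    Set.sdiff_eq_empty]
  refine ⟨fun h ↦ le_antisymm h.1 h.2, ?_⟩
  rintro rfl
  exact ⟨le_rfl, subset_rfl⟩

/-- Contracting `F` lowers the rank of every set containing `F` by the same amount, so coranks can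
be computed in `M`. -/
theorem charPoly_restrict_contract (M : Matroid α) [M.Finite] (F G : {F // M.IsFlat F})
    (hFG : F ≤ G) :
    ((M ↾ (G : Set α)) ／ (F : Set α)).charPoly =
      ∑ S ∈ ((M ↾ (G : Set α)) ／ (F : Set α)).groundFinset.powerset,
        (-1) ^ S.card * X ^ (M.rkNat G - M.rkNat (M.closure (S ∪ F))) := by
  rw [charPoly]
  refine Finset.sum_congr rfl fun S hS ↦ ?_
  rw [mem_powerset_groundFinset, contract_ground, restrict_ground_eq, Set.subset_sdiff] at hS
  have h1 := (M ↾ (G : Set α)).rkNat_contract_add F S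
  have h2 := (M ↾ (G : Set α)).rkNat_contract_add F ((G : Set α) \ F)
  have hFG' : (F : Set α) ⊆ G := hFG
  rw [rkNat_restrict _ hFG', rkNat_restrict _ (Set.union_subset hS.1 hFG')] at h1
  rw [rkNat_restrict _ hFG', Set.sdiff_union_of_subset hFG', rkNat_restrict _ subset_rfl] at h2
  rw [rkNat_closure, rankNat, contract_ground, restrict_ground_eq, ← h1, ← h2,
    Nat.add_sub_add_right]

end Minor

/-! ### Splitting off the largest flat of a flag; divisibility by powers of `q - 1` -/

section Decomposition

variable {α : Type*}

theorem isFlat_restrict_iff {M : Matroid α} {K F : Set α} (hK : M.IsFlat K) :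
    (M ↾ K).IsFlat F ↔ M.IsFlat F ∧ F ⊆ K := by
  constructor
  · intro h
    have hFK : F ⊆ K := h.subset_ground
    refine ⟨isFlat_iff_closure_eq.2 ?_, hFK⟩
    have h' := h.closure
    rw [restrict_closure_eq _ hFK hK.subset_ground, Set.inter_eq_self_of_subset_left
      ((M.closure_subset_closure hFK).trans_eq hK.closure)] at h'
    exact h'
  · rintro ⟨hF, hFK⟩
    rw [isFlat_iff_closure_eq, restrict_closure_eq _ hFK hK.subset_ground, hF.closure,
      Set.inter_eq_self_of_subset_left hFK]

theorem restrict_closure_empty {M : Matroid α} {K : Set α} (hK : M.IsFlat K) :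
    (M ↾ K).closure ∅ = M.closure ∅ := by
  rw [restrict_closure_eq _ (Set.empty_subset _) hK.subset_ground, Set.inter_eq_self_of_subset_left
      ((M.closure_subset_closure (Set.empty_subset _)).trans_eq hK.closure)]

open Classical in
theorem mem_properFlags_restrict_iff {M : Matroid α} {K : Set α} (hK : M.IsFlat K)
    (hK0 : K ≠ M.closure ∅) (hKE : K ≠ M.E) {𝓖 : Finset (Set α)} :
    𝓖 ∈ (M ↾ K).properFlags ↔ insert K 𝓖 ∈ M.properFlags ∧ ∀ F ∈ 𝓖, F ⊂ K := by
  simp only [properFlags, flags, Set.mem_ofPred_eq, isFlat_restrict_iff hK,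
    restrict_closure_empty hK, restrict_ground_eq, Finset.coe_insert]
  constructor
  · rintro ⟨⟨h1, h2⟩, h3⟩
    refine ⟨⟨⟨?_, h2.insert fun F hF _ ↦ Or.inr (h1 F hF).1.2⟩, ?_⟩, fun F hF ↦
      (h1 F hF).1.2.ssubset_of_ne fun h ↦ h3 (h ▸ hF)⟩
    · intro F hF
      rcases Finset.mem_insert.1 hF with rfl | hF
      · exact ⟨hK, hK0⟩
      · exact ⟨(h1 F hF).1.1, (h1 F hF).2⟩
    · intro hE
      rcases Finset.mem_insert.1 hE with h | hE
      · exact hKE h.symm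
      · exact hKE (hK.subset_ground.antisymm (h1 _ hE).1.2)
  · rintro ⟨⟨⟨h1, h2⟩, h3⟩, h4⟩
    refine ⟨⟨fun F hF ↦ ?_, h2.mono (Set.subset_insert _ _)⟩, fun h ↦ (h4 K h).ne rfl⟩
    have := h1 F (Finset.mem_insert_of_mem hF)
    exact ⟨⟨this.1, (h4 F hF).subset⟩, this.2⟩

/-- A nonempty flag has a largest member. -/
theorem exists_max_of_mem_flags {M : Matroid α} {𝓖 : Finset (Set α)} (h : 𝓖 ∈ M.flags)
    (hne : 𝓖.Nonempty) : ∃ K ∈ 𝓖, ∀ F ∈ 𝓖, F ⊆ K := by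
  obtain ⟨K, hK, hmax⟩ := 𝓖.exists_maximal hne
  refine ⟨K, hK, fun F hF ↦ ?_⟩
  rcases h.2.total hF hK with h | h
  · exact h
  · exact hmax hF h

theorem initialFlag_isBase_iff {M : Matroid α} [M.Finite] {𝓖 : Finset (Set α)} (h : 𝓖 ∈ M.flags)
    {B : Set α} :
    (M.initialFlag 𝓖).IsBase B ↔ M.IsBase B ∧ ∀ F ∈ 𝓖, (B ∩ F).ncard = M.rkNat F :=
  M.isMaxWeightBase_coneVector_iff h fun _ _ ↦ one_pos

theorem initialFlag_empty (M : Matroid α) [M.Finite] : M.initialFlag ∅ = M := by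
  refine ext_isBase rfl fun B _ ↦ ?_
  rw [initialFlag_isBase_iff (by simp [flags])]
  simp

theorem IsBase.ncard_inter_eq_rkNat_iff {M : Matroid α} [M.Finite] {B K : Set α}
    (hB : M.IsBase B) (hK : K ⊆ M.E) : (B ∩ K).ncard = M.rkNat K ↔ M.IsBasis (B ∩ K) K := by
  constructor
  · intro h
    have hfin : (B ∩ K).Finite := hB.finite.inter_of_left _
    refine (hB.indep.inter_right K).isBasis_of_eRk_ge hfin Set.inter_subset_right ?_
    rw [(hB.indep.inter_right K).eRk_eq_encard, ← cast_rkNat, ← h, hfin.cast_ncard_eq]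
  · intro h
    rw [rkNat, h.eRk_eq_encard, Set.ncard]

/-- Any independent set containing `B` meets `K` exactly in `B ∩ K`, since that is already a basis
of `K`. Enlarging `B` in `M` is thus the same as enlarging `B \ K` in the contraction. -/
theorem isBase_contract_iff_of_isBasis {M : Matroid α} {B K : Set α}
    (hBK : M.IsBasis (B ∩ K) K) : (M ／ K).IsBase (B \ K) ↔ M.IsBase B := by
  have hd : B \ K ∪ B ∩ K = B := Set.sdiff_union_inter _ _
  rw [isBase_iff_maximal_indep, isBase_iff_maximal_indep, maximal_subset_iff, maximal_subset_iff,
    hBK.contract_indep_iff, hd]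
  constructor
  · rintro ⟨⟨h1, -⟩, h2⟩
    refine ⟨h1, fun J hJ hBJ ↦ ?_⟩
    have hJK : J ∩ K = B ∩ K := (hBK.eq_of_subset_indep (hJ.inter_right K)
      (Set.inter_subset_inter_left _ hBJ) Set.inter_subset_right).symm
    have := h2 (t := J \ K) (by
      rw [hBK.contract_indep_iff, ← hJK, Set.sdiff_union_inter]
      exact ⟨hJ, Set.disjoint_sdiff_right⟩) (Set.sdiff_subset_sdiff_left hBJ)
    rw [← hd, this, ← hJK, Set.sdiff_union_inter]
  · rintro ⟨h1, h2⟩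
    refine ⟨⟨h1, Set.disjoint_sdiff_right⟩, fun J hJ hBJ ↦ ?_⟩
    rw [hBK.contract_indep_iff] at hJ
    have h3 : B ⊆ J ∪ B ∩ K := by
      conv_lhs => rw [← hd]
      exact Set.union_subset_union_left _ hBJ
    refine hBJ.antisymm fun x hx ↦ ?_
    rw [h2 hJ.1 h3]
    exact ⟨Or.inl hx, fun hxK ↦ Set.disjoint_left.1 hJ.2 hxK hx⟩

theorem disjoint_ground_initialFlag_restrict_contract (M : Matroid α) (K : Set α)
    [(M ↾ K).Finite] (𝓖 : Finset (Set α)) :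
    Disjoint ((M ↾ K).initialFlag 𝓖).E (M ／ K).E :=
  (Set.disjoint_sdiff_right : Disjoint K (M.E \ K))

open Classical in
/-- Adding a new largest flat `K` to a flag splits the initial matroid as a direct sum. -/
theorem initialFlag_insert (M : Matroid α) [M.Finite] {K : Set α} [(M ↾ K).Finite]
    {𝓖 : Finset (Set α)} (h : insert K 𝓖 ∈ M.flags) (h𝓖 : 𝓖 ∈ (M ↾ K).flags) :
    M.initialFlag (insert K 𝓖) =
      ((M ↾ K).initialFlag 𝓖).disjointSum (M ／ K)
        (M.disjoint_ground_initialFlag_restrict_contract K 𝓖) := by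
  have hK : M.IsFlat K := (h.1 K (Finset.mem_insert_self _ _)).1
  have hKE := hK.subset_ground
  have hE1 : ((M ↾ K).initialFlag 𝓖).E = K := rfl
  have hE2 : (M.initialFlag (insert K 𝓖)).E = M.E := rfl
  refine ext_isBase ?_ fun B hB ↦ ?_
  · rw [disjointSum_ground_eq, hE1, hE2, contract_ground, Set.union_sdiff_cancel hKE]
  rw [hE2] at hB
  have hBK : B ∩ (M.E \ K) = B \ K := by
    rw [← Set.inter_sdiff_assoc, Set.inter_eq_self_of_subset_left hB]
  rw [disjointSum_isBase_iff, initialFlag_isBase_iff h, hE1, initialFlag_isBase_iff h𝓖,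
    contract_ground, Set.union_sdiff_cancel hKE, hBK, isBase_restrict_iff]
  have hF : (∀ F ∈ 𝓖, (B ∩ K ∩ F).ncard = (M ↾ K).rkNat F) ↔
      ∀ F ∈ 𝓖, (B ∩ F).ncard = M.rkNat F := by
    refine forall₂_congr fun F hF ↦ ?_
    have hFK : F ⊆ K := (h𝓖.1 F hF).1.subset_ground
    rw [rkNat_restrict _ hFK, Set.inter_assoc, Set.inter_eq_self_of_subset_right hFK]
  rw [hF, Finset.forall_mem_insert]
  constructor
  · rintro ⟨h1, h2, h3⟩
    rw [h1.ncard_inter_eq_rkNat_iff hKE] at h2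
    exact ⟨⟨h2, h3⟩, (isBase_contract_iff_of_isBasis h2).2 h1, hB⟩
  · rintro ⟨⟨h2, h3⟩, h1, -⟩
    rw [isBase_contract_iff_of_isBasis h2] at h1
    exact ⟨h1, (h1.ncard_inter_eq_rkNat_iff hKE).2 h2, h3⟩

theorem X_sub_one_ne_zero : (X - 1 : ℤ[X]) ≠ 0 := X_sub_C_ne_zero 1

-- Both summands and the whole matroid have nonempty ground set, because `K` is neither minimal nor
-- `E`. Each of the three characteristic polynomials is then `q - 1` times the reduced one, and one
-- factor is left over.
open Classical in
theorem redCharPoly_initialFlag_insert (M : Matroid α) [M.Finite] {K : Set α} [(M ↾ K).Finite]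
    {𝓖 : Finset (Set α)} (hK : M.IsFlat K) (hK0 : K ≠ M.closure ∅) (hKE : K ≠ M.E)
    (h𝓖 : 𝓖 ∈ (M ↾ K).properFlags) :
    (M.initialFlag (insert K 𝓖)).redCharPoly =
      (X - 1) * (((M ↾ K).initialFlag 𝓖).redCharPoly * (M ／ K).redCharPoly) := by
  have hKne : K.Nonempty := by
    rw [Set.nonempty_iff_ne_empty]
    rintro rfl
    exact hK0 hK.closure.symm
  have : ((M ↾ K).initialFlag 𝓖).Nonempty := ⟨hKne⟩
  have : (M ／ K).Nonempty :=
    ⟨Set.nonempty_of_ssubset (hK.subset_ground.ssubset_of_ne hKE)⟩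
  have : (M.initialFlag (insert K 𝓖)).Nonempty := ⟨hKne.mono hK.subset_ground⟩
  have h := ((mem_properFlags_restrict_iff hK hK0 hKE).1 h𝓖).1.1
  have h1 : (M.initialFlag (insert K 𝓖)).charPoly =
      ((M ↾ K).initialFlag 𝓖).charPoly * (M ／ K).charPoly := by
    rw [← charPoly_disjointSum
      (M.disjoint_ground_initialFlag_restrict_contract K 𝓖)]
    congr 1
    exact M.initialFlag_insert h h𝓖.1
  rw [charPoly_eq_mul_redCharPoly, charPoly_eq_mul_redCharPoly, charPoly_eq_mul_redCharPoly] at h1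
  refine mul_left_cancel₀ X_sub_one_ne_zero ?_
  rw [h1]
  ring

theorem pow_card_dvd_redCharPoly (M : Matroid α) [M.Finite] {𝓖 : Finset (Set α)}
    (h𝓖 : 𝓖 ∈ M.properFlags) :
    (X - 1 : ℤ[X]) ^ 𝓖.card ∣ (M.initialFlag 𝓖).redCharPoly := by
  classical
  -- The matroid must vary: the induction step passes to the restriction to the largest flat.
  induction hn : 𝓖.card generalizing M 𝓖 with
  | zero => simp
  | succ n ih =>
    obtain ⟨K, hK𝓖, hmax⟩ := exists_max_of_mem_flags h𝓖.1 (Finset.card_pos.1 (by omega))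
    have hK := h𝓖.1.1 K hK𝓖
    have hKE : K ≠ M.E := fun h ↦ h𝓖.2 (h ▸ hK𝓖)
    have : (M ↾ K).Finite := ⟨M.ground_finite.subset hK.1.subset_ground⟩
    have h : 𝓖.erase K ∈ (M ↾ K).properFlags := by
      rw [mem_properFlags_restrict_iff hK.1 hK.2 hKE, Finset.insert_erase hK𝓖]
      exact ⟨h𝓖, fun F hF ↦ (hmax F (Finset.mem_of_mem_erase hF)).ssubset_of_ne
        (Finset.ne_of_mem_erase hF)⟩
    rw [← Finset.insert_erase hK𝓖, redCharPoly_initialFlag_insert M hK.1 hK.2 hKE h, pow_succ']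
    refine mul_dvd_mul_left _ (Dvd.dvd.mul_right (ih _ h ?_) _)
    rw [Finset.card_erase_of_mem hK𝓖, hn, Nat.add_sub_cancel]

open Classical in
theorem redCharPoly_initialFlag_insert_div (M : Matroid α) [M.Finite] {K : Set α} [(M ↾ K).Finite]
    {𝓖 : Finset (Set α)} (hK : M.IsFlat K) (hK0 : K ≠ M.closure ∅) (hKE : K ≠ M.E)
    (h𝓖 : 𝓖 ∈ (M ↾ K).properFlags) :
    (M.initialFlag (insert K 𝓖)).redCharPoly /ₘ (X - 1) ^ (insert K 𝓖).card =
      ((M ↾ K).initialFlag 𝓖).redCharPoly /ₘ (X - 1) ^ 𝓖.card * (M ／ K).redCharPoly := by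
  have hm : (X - 1 : ℤ[X]).Monic := monic_X_sub_C 1
  obtain ⟨p, hp⟩ := pow_card_dvd_redCharPoly (M ↾ K) h𝓖
  rw [redCharPoly_initialFlag_insert M hK hK0 hKE h𝓖, hp, Finset.card_insert_of_notMem (show K ∉ 𝓖 from h𝓖.2),
    mul_divByMonic_cancel_left _ (hm.pow _)]
  have : (X - 1) * ((X - 1) ^ 𝓖.card * p * (M ／ K).redCharPoly) =
      (X - 1 : ℤ[X]) ^ (𝓖.card + 1) * (p * (M ／ K).redCharPoly) := by ring
  rw [this, mul_divByMonic_cancel_left _ (hm.pow _)]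

theorem redCharPoly_eq_zero_of_ground_eq_empty {M : Matroid α} [M.Finite] (h : M.E = ∅) :
    M.redCharPoly = 0 := by
  have : M.rankNat = 0 := by rw [rankNat, h, rkNat, eRk_empty]; rfl
  simp [redCharPoly, qAnalogue, this]

theorem poincarePoly_eq_zero_of_ground_eq_empty {M : Matroid α} [M.Finite] (h : M.E = ∅)
    (𝓕 : Finset (Set α)) : M.poincarePoly 𝓕 = 0 := by
  refine Finset.sum_eq_zero fun 𝓖 _ ↦ ?_
  have : (M.initialFlag 𝓖).redCharPoly = 0 := redCharPoly_eq_zero_of_ground_eq_empty h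
  rw [this, zero_divByMonic]

end Decomposition

/-! ### Recursion for Poincaré polynomials along the top of a flag -/

section Recursion

variable {α : Type*}

theorem mem_properFlagsAbove {M : Matroid α} [M.Finite] {𝓕 𝓖 : Finset (Set α)} :
    𝓖 ∈ M.properFlagsAbove 𝓕 ↔ 𝓖 ∈ M.properFlags ∧ 𝓕 ⊆ 𝓖 := by
  simp [properFlagsAbove]

instance (M : Matroid α) : OrderBot {F // M.IsFlat F} where
  bot := ⟨M.closure ∅, M.isFlat_closure ∅⟩
  bot_le F := (M.closure_subset_closure (Set.empty_subset _)).trans_eq F.2.closure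

theorem coe_bot_isFlat (M : Matroid α) : ((⊥ : {F // M.IsFlat F}) : Set α) = M.closure ∅ := rfl

/-- The closure of the union of a flag, which is its largest member if the flag is nonempty. -/
def flagTop (M : Matroid α) (𝓖 : Finset (Set α)) : {F // M.IsFlat F} :=
  ⟨M.closure (⋃₀ (𝓖 : Set (Set α))), M.isFlat_closure _⟩

theorem flagTop_empty (M : Matroid α) : M.flagTop ∅ = ⊥ :=
  Subtype.ext (by simp [flagTop, coe_bot_isFlat])

theorem coe_flagTop_eq {M : Matroid α} {𝓖 : Finset (Set α)} {K : Set α} (hK : M.IsFlat K)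
    (hK𝓖 : K ∈ 𝓖) (hmax : ∀ F ∈ 𝓖, F ⊆ K) : (M.flagTop 𝓖 : Set α) = K := by
  have : ⋃₀ (𝓖 : Set (Set α)) = K :=
    (Set.sUnion_subset hmax).antisymm (Set.subset_sUnion_of_mem hK𝓖)
  show M.closure _ = K
  rw [this, hK.closure]

variable (M : Matroid α) [M.Finite] (𝓕 : Finset (Set α))

open Classical in
/-- The set of flats of `M` that belong to `𝓕`. -/
noncomputable def flatsIn : Finset {F // M.IsFlat F} := Finset.univ.filter fun F ↦ (F : Set α) ∈ 𝓕

variable {𝓕}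

theorem mem_flatsIn {F : {F // M.IsFlat F}} : F ∈ M.flatsIn 𝓕 ↔ (F : Set α) ∈ 𝓕 := by
  simp [flatsIn]

open Classical in
theorem isStep_flagTop {G : {F // M.IsFlat F}} (hG : G ≠ ⊥)
    {𝓖 : Finset (Set α)}
    (h𝓖 : 𝓖 ∈ (M ↾ (G : Set α)).properFlagsAbove (𝓕.filter (· ⊂ (G : Set α)))) :
    IsStep (M.flatsIn 𝓕) (M.flagTop 𝓖) G := by
  rw [mem_properFlagsAbove] at h𝓖
  have hF : ∀ F ∈ M.flatsIn 𝓕, F < G → (F : Set α) ∈ 𝓖 := fun F hF hFG ↦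
    h𝓖.2 (Finset.mem_filter.2 ⟨M.mem_flatsIn.1 hF, hFG⟩)
  rcases 𝓖.eq_empty_or_nonempty with rfl | hne
  · rw [flagTop_empty]
    exact ⟨bot_lt_iff_ne_bot.2 hG, fun F hF' hFG ↦ absurd (hF F hF' hFG) (Finset.notMem_empty _)⟩
  · obtain ⟨K, hK𝓖, hmax⟩ := exists_max_of_mem_flags h𝓖.1.1 hne
    have hK := (isFlat_restrict_iff G.2).1 (h𝓖.1.1.1 K hK𝓖).1
    have htop := coe_flagTop_eq hK.1 hK𝓖 hmax
    refine ⟨?_, fun F hF' hFG ↦ ?_⟩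
    · show (M.flagTop 𝓖 : Set α) ⊂ G
      rw [htop]
      exact hK.2.ssubset_of_ne fun h ↦ h𝓖.1.2 (by rw [restrict_ground_eq, ← h]; exact hK𝓖)
    · show (F : Set α) ⊆ M.flagTop 𝓖
      rw [htop]
      exact hmax _ (hF F hF' hFG)

-- Members of a flag are not minimal, so only the empty flag has top `⊥`. It is an admissible flag
-- because a step from `⊥` to `G` leaves no member of `𝓕` strictly below `G`.
open Classical in
theorem sum_flagTop_eq_bot {G : {F // M.IsFlat F}} (hstep : IsStep (M.flatsIn 𝓕) ⊥ G)
    (h𝓕 : ∀ F ∈ 𝓕, M.IsFlat F) (h𝓕0 : M.closure ∅ ∉ 𝓕) :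
    ∑ 𝓖 ∈ (M ↾ (G : Set α)).properFlagsAbove (𝓕.filter (· ⊂ (G : Set α))) with M.flagTop 𝓖 = ⊥,
      ((M ↾ (G : Set α)).initialFlag 𝓖).redCharPoly /ₘ (X - 1) ^ 𝓖.card =
    (M ↾ (G : Set α)).redCharPoly := by
  rw [Finset.sum_eq_single ∅]
  · simp [initialFlag_empty]
  · intro 𝓖 h𝓖 hne
    rw [Finset.mem_filter, mem_properFlagsAbove] at h𝓖
    obtain ⟨K, hK𝓖, hmax⟩ := exists_max_of_mem_flags h𝓖.1.1.1 (Finset.nonempty_iff_ne_empty.2 hne)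
    have hK := h𝓖.1.1.1.1 K hK𝓖
    have htop := coe_flagTop_eq ((isFlat_restrict_iff G.2).1 hK.1).1 hK𝓖 hmax
    rw [h𝓖.2, coe_bot_isFlat] at htop
    rw [restrict_closure_empty G.2] at hK
    exact absurd htop.symm hK.2
  · intro h
    refine absurd (Finset.mem_filter.2 ⟨mem_properFlagsAbove.2 ⟨?_, ?_⟩, M.flagTop_empty⟩) h
    · simp [properFlags, flags]
    · rw [Finset.subset_empty, Finset.filter_eq_empty_iff]
      intro F hF hFG
      have := hstep.2 ⟨F, h𝓕 F hF⟩ (M.mem_flatsIn.2 hF) hFG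
      rw [le_bot_iff] at this
      exact h𝓕0 (by rw [← coe_bot_isFlat, ← this]; exact hF)

-- Inserting `K` is a bijection from the flags of `M ↾ K` onto the flags of `M ↾ G` with top `K`,
-- and each quotient acquires the factor of the interval from `K` to `G`.
open Classical in
theorem sum_flagTop_eq {K G : {F // M.IsFlat F}} (hstep : IsStep (M.flatsIn 𝓕) K G)
    (hK0 : K ≠ ⊥) (h𝓕 : ∀ F ∈ 𝓕, M.IsFlat F) :
    ∑ 𝓖 ∈ (M ↾ (G : Set α)).properFlagsAbove (𝓕.filter (· ⊂ (G : Set α))) with M.flagTop 𝓖 = K,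
      ((M ↾ (G : Set α)).initialFlag 𝓖).redCharPoly /ₘ (X - 1) ^ 𝓖.card =
    (M ↾ (K : Set α)).poincarePoly (𝓕.filter (· ⊂ (K : Set α))) *
      ((M ↾ (G : Set α)) ／ (K : Set α)).redCharPoly := by
  have hKG : (K : Set α) ⊂ G := hstep.1
  have hr : (M ↾ (G : Set α)) ↾ (K : Set α) = M ↾ (K : Set α) := M.restrict_restrict_eq hKG.subset
  have hfin : ((M ↾ (G : Set α)) ↾ (K : Set α)).Finite := by rw [hr]; infer_instance
  have hKf : (M ↾ (G : Set α)).IsFlat K := (isFlat_restrict_iff G.2).2 ⟨K.2, hKG.subset⟩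
  have hKc : (K : Set α) ≠ (M ↾ (G : Set α)).closure ∅ := by
    rw [restrict_closure_empty G.2]
    exact fun h ↦ hK0 (Subtype.ext h)
  have hKE : (K : Set α) ≠ (M ↾ (G : Set α)).E := hKG.ne
  have hmem : ∀ 𝓖, 𝓖 ∈ (M ↾ (K : Set α)).properFlags ↔ _ := fun 𝓖 ↦
    hr ▸ mem_properFlags_restrict_iff hKf hKc hKE (𝓖 := 𝓖)
  rw [poincarePoly, Finset.sum_mul]
  symm
  refine Finset.sum_bij' (fun 𝓖 _ ↦ insert (K : Set α) 𝓖) (fun 𝓖 _ ↦ 𝓖.erase (K : Set α))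
    ?_ ?_ ?_ ?_ ?_
  · intro 𝓖 h𝓖
    rw [mem_properFlagsAbove, hmem] at h𝓖
    rw [Finset.mem_filter, mem_properFlagsAbove]
    refine ⟨⟨h𝓖.1.1, fun F hF ↦ ?_⟩, Subtype.ext (coe_flagTop_eq K.2
      (Finset.mem_insert_self _ _) fun F hF ↦ ?_)⟩
    · rw [Finset.mem_filter] at hF
      -- The step condition reduces containing the members of `𝓕` below `G` to containing those
      -- below `K`, together with `K` itself if it lies in `𝓕`.
      have hFK : F ⊆ K := hstep.2 ⟨F, h𝓕 F hF.1⟩ (M.mem_flatsIn.2 hF.1) hF.2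
      rcases eq_or_ne F K with h | h
      · exact h ▸ Finset.mem_insert_self _ _
      · exact Finset.mem_insert_of_mem (h𝓖.2 (Finset.mem_filter.2 ⟨hF.1, hFK.ssubset_of_ne h⟩))
    · rcases Finset.mem_insert.1 hF with rfl | hF
      · exact subset_rfl
      · exact (h𝓖.1.2 F hF).subset
  · intro 𝓖 h𝓖
    rw [Finset.mem_filter, mem_properFlagsAbove] at h𝓖
    have hne : 𝓖.Nonempty := by
      rw [Finset.nonempty_iff_ne_empty]
      rintro rfl
      exact hK0 (h𝓖.2.symm.trans M.flagTop_empty)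
    obtain ⟨K', hK'𝓖, hmax⟩ := exists_max_of_mem_flags h𝓖.1.1.1 hne
    have htop := coe_flagTop_eq ((isFlat_restrict_iff G.2).1 (h𝓖.1.1.1.1 K' hK'𝓖).1).1 hK'𝓖 hmax
    rw [h𝓖.2] at htop
    subst htop
    rw [mem_properFlagsAbove, hmem, Finset.insert_erase hK'𝓖]
    refine ⟨⟨h𝓖.1.1, fun F hF ↦ (hmax F (Finset.mem_of_mem_erase hF)).ssubset_of_ne
      (Finset.ne_of_mem_erase hF)⟩, fun F hF ↦ ?_⟩
    rw [Finset.mem_filter] at hF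
    exact Finset.mem_erase.2 ⟨hF.2.ne, h𝓖.1.2 (Finset.mem_filter.2 ⟨hF.1, hF.2.trans hKG⟩)⟩
  · intro 𝓖 h𝓖
    exact Finset.erase_insert (mem_properFlagsAbove.1 h𝓖).1.2
  · intro 𝓖 h𝓖
    rw [Finset.mem_filter, mem_properFlagsAbove] at h𝓖
    have hne : 𝓖.Nonempty := by
      rw [Finset.nonempty_iff_ne_empty]
      rintro rfl
      exact hK0 (h𝓖.2.symm.trans M.flagTop_empty)
    obtain ⟨K', hK'𝓖, hmax⟩ := exists_max_of_mem_flags h𝓖.1.1.1 hne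
    have htop := coe_flagTop_eq ((isFlat_restrict_iff G.2).1 (h𝓖.1.1.1.1 K' hK'𝓖).1).1 hK'𝓖 hmax
    rw [h𝓖.2] at htop
    subst htop
    exact Finset.insert_erase hK'𝓖
  · intro 𝓖 h𝓖
    rw [mem_properFlagsAbove] at h𝓖
    have := redCharPoly_initialFlag_insert_div (M ↾ (G : Set α)) hKf hKc hKE (hr ▸ h𝓖.1)
    rw [this]
    congr 3
    congr 1
    exact hr.symm

-- Sort the flags by their largest member `K`, with `⊥` standing for the empty flag. Looplessness
-- makes `⊥` the empty set: contracting it changes nothing, and the Poincaré polynomial of `M ↾ ⊥`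
-- is zero, in agreement with the empty sum.
open Classical in
theorem poincarePoly_restrict_eq_sum [M.Loopless] (h𝓕 : ∀ F ∈ 𝓕, M.IsFlat F)
    (h𝓕0 : M.closure ∅ ∉ 𝓕) (G : {F // M.IsFlat F}) :
    (M ↾ (G : Set α)).poincarePoly (𝓕.filter (· ⊂ (G : Set α))) =
      ∑ K with IsStep (M.flatsIn 𝓕) K G,
        (if K = ⊥ then 1 else (M ↾ (K : Set α)).poincarePoly (𝓕.filter (· ⊂ (K : Set α)))) *
          ((M ↾ (G : Set α)) ／ (K : Set α)).redCharPoly := by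
  have hbot : M.closure ∅ = ∅ := M.loops_eq_empty
  by_cases hG : G = ⊥
  · subst hG
    rw [Finset.filter_false_of_mem fun K _ (h : IsStep _ K _) ↦ not_lt_bot h.1, Finset.sum_empty]
    exact poincarePoly_eq_zero_of_ground_eq_empty hbot _
  rw [poincarePoly, ← Finset.sum_fiberwise_of_maps_to (g := M.flagTop)
    (t := Finset.univ.filter fun K ↦ IsStep (M.flatsIn 𝓕) K G)
    fun 𝓖 h𝓖 ↦ by simpa using M.isStep_flagTop hG h𝓖]
  refine Finset.sum_congr rfl fun K hK ↦ ?_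
  replace hK : IsStep (M.flatsIn 𝓕) K G := by simpa using hK
  split_ifs with hK0
  · subst hK0
    rw [M.sum_flagTop_eq_bot hK h𝓕 h𝓕0, one_mul]
    congr 1
    rw [coe_bot_isFlat, hbot, contract_empty]
  · exact M.sum_flagTop_eq hK hK0 h𝓕

end Recursion

/-! ### The kernel of the lattice of flats and palindromicity -/

section Palindromic

open LaurentPolynomial

variable {α : Type*} (M : Matroid α) [M.Finite]

open Classical in
/-- The matrix of reduced characteristic polynomials of the proper intervals of the lattice of
flats. -/
noncomputable def redCharMatrix : Matrix {F // M.IsFlat F} {F // M.IsFlat F} ℤ[T;T⁻¹] :=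
  Matrix.of fun F G ↦
    if F < G then toLaurent ((M ↾ (G : Set α)) ／ (F : Set α)).redCharPoly else 0

/-- On a proper interval the factor `q - 1` restores the full characteristic polynomial; on the
diagonal only the empty set contributes, giving `1`. This is the hypothesis of `sub_reversal_eq`. -/
theorem one_add_smul_redCharMatrix [DecidableEq {F // M.IsFlat F}] (F G : {F // M.IsFlat F}) :
    (1 + (T 1 - 1 : ℤ[T;T⁻¹]) • M.redCharMatrix) F G =
      ∑ H, (M.flatMoebius F H : ℤ[T;T⁻¹]) * (zetaMatrix {F // M.IsFlat F} ℤ[T;T⁻¹] H G *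
        T ((M.rkNat G : ℤ) - M.rkNat H)) := by
  classical
  rw [M.sum_flatMoebius F G fun H ↦ T ((M.rkNat G : ℤ) - M.rkNat H), Matrix.add_apply,
    Matrix.smul_apply, redCharMatrix, Matrix.of_apply, smul_eq_mul]
  by_cases hFG : F < G
  · have : ((M ↾ (G : Set α)) ／ (F : Set α)).Nonempty := ⟨Set.nonempty_of_ssubset hFG⟩
    have hT : (T 1 - 1 : ℤ[T;T⁻¹]) = toLaurent (X - 1) := by
      rw [map_sub, toLaurent_X, toLaurent_one]
    rw [Matrix.one_apply_ne hFG.ne, zero_add, if_pos hFG, if_pos hFG.le, hT, ← map_mul,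
      ← charPoly_eq_mul_redCharPoly, M.charPoly_restrict_contract F G hFG.le, map_sum]
    refine Finset.sum_congr rfl fun S hS ↦ ?_
    rw [mem_powerset_groundFinset, contract_ground, restrict_ground_eq, Set.subset_sdiff] at hS
    have hsub : (S : Set α) ∪ F ⊆ G := Set.union_subset hS.1 hFG.le
    have hle : M.rkNat (M.closure (S ∪ F)) ≤ M.rkNat G := by
      rw [rkNat_closure]
      exact M.rkNat_mono hsub
    rw [map_mul, toLaurent_X_pow, map_pow, map_neg, map_one, Nat.cast_sub hle]
  · rw [if_neg hFG, mul_zero, add_zero]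
    by_cases h : F = G
    · subst h
      have he : ((M ↾ (F : Set α)) ／ (F : Set α)).groundFinset = ∅ := by
        rw [← Finset.coe_eq_empty, coe_groundFinset, contract_ground, restrict_ground_eq,
          Set.sdiff_self]
      rw [Matrix.one_apply_eq, if_pos le_rfl, he]
      simp [F.2.closure]
    · rw [Matrix.one_apply_ne h, if_neg fun hle ↦ hFG (hle.lt_of_ne h)]

theorem invert_poincarePoly [M.Loopless] {𝓕 : Finset (Set α)} (h𝓕 : 𝓕 ∈ M.properFlags) :
    invert (toLaurent (M.poincarePoly 𝓕)) =
      T (-((M.rankNat : ℤ) - 1 - (𝓕.card : ℤ))) * toLaurent (M.poincarePoly 𝓕) := by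
  classical
  have hflat : ∀ F ∈ 𝓕, M.IsFlat F := fun F hF ↦ (h𝓕.1.1 F hF).1
  have h0 : M.closure ∅ ∉ 𝓕 := fun h ↦ (h𝓕.1.1 _ h).2 rfl
  have hss : ∀ F ∈ 𝓕, F ⊂ M.E := fun F hF ↦
    (hflat F hF).subset_ground.ssubset_of_ne fun h ↦ h𝓕.2 (h ▸ hF)
  -- The chain sum is taken up to the top flat `E`, where every member of `𝓕` lies strictly below
  -- and the restriction is `M` itself.
  have key := invert_chainSum (fun F : {F // M.IsFlat F} ↦ (M.rkNat F : ℤ)) (M.flatsIn 𝓕)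
    (fun h ↦ h0 (M.mem_flatsIn.1 h)) M.redCharMatrix
    (fun F G h ↦ if_neg h)
    (sub_reversal_eq _ M.flatMoebius M.flatMoebius_mul_zeta _ M.one_add_smul_redCharMatrix)
    (fun G ↦ toLaurent ((M ↾ (G : Set α)).poincarePoly (𝓕.filter (· ⊂ (G : Set α)))))
    (fun G ↦ by
      rw [M.poincarePoly_restrict_eq_sum hflat h0 G, map_sum]
      refine Finset.sum_congr rfl fun K hK ↦ ?_
      replace hK : IsStep (M.flatsIn 𝓕) K G := by simpa using hK
      rw [map_mul, redCharMatrix, Matrix.of_apply, if_pos hK.1]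
      split_ifs
      · rw [toLaurent_one]
      · rfl) ⟨M.E, M.ground_isFlat⟩
  have hfilter : 𝓕.filter (· ⊂ M.E) = 𝓕 := Finset.filter_true_of_mem hss
  have hcard : ((M.flatsIn 𝓕).filter (· < ⟨M.E, M.ground_isFlat⟩)).card = 𝓕.card := by
    refine Finset.card_bij' (fun F _ ↦ (F : Set α)) (fun F hF ↦ ⟨F, hflat F hF⟩) ?_ ?_ ?_ ?_
    · intro F hF
      exact M.mem_flatsIn.1 (Finset.mem_filter.1 hF).1
    · intro F hF
      exact Finset.mem_filter.2 ⟨M.mem_flatsIn.2 hF, hss F hF⟩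
    · intro F _
      rfl
    · intro F _
      rfl
  have hrk : M.rkNat (M.closure ∅) = 0 := by rw [rkNat_closure, rkNat, eRk_empty]; rfl
  have : (M ↾ M.E).Finite := ⟨M.ground_finite⟩
  have hP : (M ↾ M.E).poincarePoly 𝓕 = M.poincarePoly 𝓕 := by
    congr 1
    exact M.restrict_ground_eq_self
  simp only [hfilter, hcard, coe_bot_isFlat, hrk] at key
  rw [hP] at key
  rw [key, rankNat, Nat.cast_zero, sub_zero]

end Palindromic

end Matroid

/-- For a loopless matroid `M` with finite ground set and `𝓕 ∈ 𝓝°(M)`: all quotients in the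
definition of the Poincaré polynomial of `M` at `𝓕` are exact in `ℤ[q]`, and this polynomial is
palindromic, as an identity in `ℤ[q, q⁻¹]`. -/
theorem mainTheorem4 {α : Type*} (M : Matroid α) [M.Finite] [M.Loopless]
    (𝓕 : Finset (Set α)) (h𝓕 : 𝓕 ∈ M.properFlags) :
    (∀ 𝓖 ∈ M.properFlags, 𝓕 ⊆ 𝓖 →
      ((X : ℤ[X]) - 1) ^ 𝓖.card ∣ (M.initialFlag 𝓖).redCharPoly) ∧
    LaurentPolynomial.invert (Polynomial.toLaurent (M.poincarePoly 𝓕)) =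
      LaurentPolynomial.T (-((M.rankNat : ℤ) - 1 - (𝓕.card : ℤ))) *
        Polynomial.toLaurent (M.poincarePoly 𝓕) :=
  ⟨fun _ h𝓖 _ ↦ M.pow_card_dvd_redCharPoly h𝓖, M.invert_poincarePoly h𝓕⟩
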